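/- A left ordering of a group $G$ is a strict total order $<$ on $G$ with $g<g' \Rightarrow hg<hg'$ for all $g,g',h\in G$; its positive cone is $\{g\in G : 1<g\}$. The set $\mathrm{LO}(G)$ of left orderings carries the topology induced by the product topology on $\{+,-\}^{G\setminus\{1\}}$ (with $\{+,-\}$ discrete), an ordering being sent to the signs of the elements $g\neq 1$; a left ordering is isolated if it is an isolated point of $\mathrm{LO}(G)$. Let $\mathcal S=\{s_1,\dots,s_k\}$ be an ordered finite generating set of $G$. A word on $\mathcal S\cup\mathcal S^{-1}$ is $i$-positive if it contains at least one $s_i$ but none of $s_1^{\pm1},\dots,s_{i-1}^{\pm1},s_i^{-1}$; an element of $G$ is $\sigma(\mathcal S)$-positive if for some $1\le i\le k$ it is represented by an $i$-positive word. We say that $\mathcal S$ defines a Dehornoy-like ordering if the set of $\sigma(\mathcal S)$-positive elements is the positive cone of a left ordering of $G$. We say that a finite generating set $\mathcal A$ of $G$ defines an isolated left ordering if the set of elements represented by non-empty words on $\mathcal A$ (without inverses) is the positive cone of an isolated left ordering of $G$. Theorem 3.1. Let $m,n\ge 2$ be integers with $(m,n)\neq(2,2)$, and let $G_{m,n}=\langle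 x,y \mid x^m=y^n\rangle$. Then $\mathcal S=\{s_1=xyx^{-m+1},\ s_2=x^{m-1}y^{-1}\}$ and $\mathcal A=\{a=x,\ b=yx^{-m+1}\}$ are generating sets of $G_{m,n}$, and 1. $\mathcal S$ (ordered as $s_1,s_2$) defines a Dehornoy-like ordering $<_D$ of $G_{m,n}$; 2. $\mathcal A$ defines an isolated left ordering $<_A$ of $G_{m,n}$. -/

import Mathlib

/-- A left ordering of a group: a strict total order preserved by left multiplication. -/
@[ext]
structure LeftOrdering (G : Type*) [Group G] where
  /-- the strict order relation -/
  lt : G → G → Prop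
  irrefl : ∀ g, ¬ lt g g
  trans : ∀ g h k, lt g h → lt h k → lt g k
  total : ∀ g h, lt g h ∨ g = h ∨ lt h g
  mul_left : ∀ k g h, lt g h → lt (k * g) (k * h)

namespace LeftOrdering

variable {G : Type*} [Group G]

/-- The positive cone `{g | 1 < g}`. -/
def positiveCone (o : LeftOrdering G) : Set G := {g | o.lt 1 g}

open Classical in
/-- The point of `{+,-}^(G - {1})` that corresponds to a left ordering. -/
noncomputable def sign (o : LeftOrdering G) : {g : G // g ≠ 1} → Bool :=
  fun g => decide (g.1 ∈ o.positiveCone)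

/-- The topology of the space `LO(G)` of left orderings: it is induced by the product topology
on `{+,-}^(G - {1})`, where `{+,-}` is discrete. -/
noncomputable instance : TopologicalSpace (LeftOrdering G) :=
  TopologicalSpace.induced sign inferInstance

/-- An isolated ordering is an isolated point of `LO(G)`. -/
def IsIsolated (o : LeftOrdering G) : Prop := IsOpen ({o} : Set (LeftOrdering G))

end LeftOrdering

section Words

variable {G : Type*} [Group G] {k : ℕ}

/-- The family `S = (s_1, ..., s_k)` (indexed from `0`) generates `G`. -/
def IsGenerating (S : Fin k → G) : Prop := Subgroup.closure (Set.range S) = ⊤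

/-- The element represented by a word on `S ∪ S⁻¹`; the letter `(i, true)` stands for `s_i` and
the letter `(i, false)` for `s_i⁻¹`. -/
def wordEval (S : Fin k → G) (w : List (Fin k × Bool)) : G :=
  (w.map fun p => cond p.2 (S p.1) (S p.1)⁻¹).prod

/-- A word is `i`-positive if it contains the letter `s_i`, but neither `s_i⁻¹` nor any
`s_j` or `s_j⁻¹` with `j < i`. -/
def IsPositiveWord (i : Fin k) (w : List (Fin k × Bool)) : Prop :=
  (i, true) ∈ w ∧ (i, false) ∉ w ∧ ∀ p ∈ w, i ≤ p.1

/-- The set of `σ(S)`-positive elements: those represented by an `i`-positive word for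
some `i`. -/
def sigmaPositive (S : Fin k → G) : Set G :=
  {g | ∃ i w, IsPositiveWord i w ∧ wordEval S w = g}

/-- The elements represented by non-empty words on `S` without inverse letters. -/
def wordPositive (S : Fin k → G) : Set G :=
  (Subsemigroup.closure (Set.range S) : Set G)

/-- `S` is a finite ordered generating set whose `σ(S)`-positive elements are the positive cone
of a left ordering. -/
def DefinesDehornoyLikeOrdering (S : Fin k → G) : Prop :=
  IsGenerating S ∧ ∃ o : LeftOrdering G, o.positiveCone = sigmaPositive S

/-- `S` is a finite generating set whose word positive elements are the positive cone of an
isolated left ordering. -/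
def DefinesIsolatedOrdering (S : Fin k → G) : Prop :=
  IsGenerating S ∧ ∃ o : LeftOrdering G, o.positiveCone = wordPositive S ∧ o.IsIsolated

end Words

/-- The group `⟨x, y | x ^ m = y ^ n⟩`. -/
abbrev TorusGroup (m n : ℕ) : Type :=
  PresentedGroup
    ({FreeGroup.of 0 ^ m * (FreeGroup.of 1 ^ n)⁻¹} : Set (FreeGroup (Fin 2)))

namespace TorusGroup

/-- The generator `x`. -/
def x (m n : ℕ) : TorusGroup m n := PresentedGroup.of 0

/-- The generator `y`. -/
def y (m n : ℕ) : TorusGroup m n := PresentedGroup.of 1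

/-- The ordered generating set `(x y x^(-m+1), x^(m-1) y⁻¹)`. -/
def genS (m n : ℕ) : Fin 2 → TorusGroup m n :=
  ![x m n * y m n * x m n ^ (-(m : ℤ) + 1), x m n ^ ((m : ℤ) - 1) * (y m n)⁻¹]

/-- The ordered generating set `(x, y x^(-m+1))`. -/
def genA (m n : ℕ) : Fin 2 → TorusGroup m n :=
  ![x m n, y m n * x m n ^ (-(m : ℤ) + 1)]

end TorusGroup

/-!
Let `a = x`, `b = y * x ^ (-m + 1)`, let `P` be the semigroup generated by `a` and `b`, and let
`M` be `P` with `1` adjoined. The central element `x ^ m = y ^ n` brings every group element into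
the form `x ^ k * h`, where `h` is a product of blocks `y ^ j * x ^ (-i)` followed by a power of
`y`, and both `h` and `h⁻¹ * x` lie in `M`. The sign of `k` therefore decides whether the element
or its inverse lies in `M`. That `1 ∉ P` is seen on the real line: `x` and `y` act by lifts of
circle homeomorphisms whose powers `x ^ m` and `y ^ n` are the translation by `1`, and if the
action of `y` is suitably conjugated, then `a` and `b` move a common point to the right. So `P` is
a positive cone, and the ordering is isolated because its cone is a finitely generated semigroup.

Moreover `a * b⁻¹ * a⁻¹`, `a⁻¹ * b⁻¹ * a` and `a⁻¹ * b⁻¹ * a * b⁻¹ * a⁻¹` lie in `M`, and hence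
all `b ^ j * a * b ^ k` lie in `P`. A word on `s₁ = a * b` and `s₂ = b⁻¹` that contains `s₁` but
not `s₁⁻¹` represents a product of such elements, so the `σ(s₁, s₂)`-positive elements are
obtained from `P` by replacing the powers of `b` with their inverses, and this is again a positive
cone.
-/

namespace LeftOrdering

variable {G : Type*} [Group G]

/-- The left ordering whose positive cone is the given subsemigroup. -/
def ofPositiveCone (P : Subsemigroup G) (hone : 1 ∉ P) (htotal : ∀ g ≠ 1, g ∈ P ∨ g⁻¹ ∈ P) :
    LeftOrdering G where
  lt g h := g⁻¹ * h ∈ P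
  irrefl g := by rwa [inv_mul_cancel]
  trans g h k hgh hhk := by simpa [mul_assoc] using mul_mem hgh hhk
  total g h := by
    rcases eq_or_ne g h with rfl | hgh
    · exact .inr (.inl rfl)
    · refine (htotal (g⁻¹ * h) (by rwa [Ne, inv_mul_eq_one])).imp_right fun hinv => .inr ?_
      rwa [mul_inv_rev, inv_inv] at hinv
  mul_left k g h hgh := by simpa [mul_assoc] using hgh

theorem positiveCone_ofPositiveCone (P : Subsemigroup G) (hone : 1 ∉ P)
    (htotal : ∀ g ≠ 1, g ∈ P ∨ g⁻¹ ∈ P) : (ofPositiveCone P hone htotal).positiveCone = P := by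
  ext g
  simp [positiveCone, ofPositiveCone]

theorem one_notMem_positiveCone (o : LeftOrdering G) : 1 ∉ o.positiveCone := o.irrefl 1

theorem lt_iff_inv_mul_mem_positiveCone (o : LeftOrdering G) {g h : G} :
    o.lt g h ↔ g⁻¹ * h ∈ o.positiveCone :=
  ⟨fun hgh => by simpa [positiveCone] using o.mul_left g⁻¹ g h hgh,
    fun hgh => by simpa using o.mul_left g 1 _ hgh⟩

theorem mem_or_inv_mem_positiveCone (o : LeftOrdering G) {g : G} (hg : g ≠ 1) :
    g ∈ o.positiveCone ∨ g⁻¹ ∈ o.positiveCone := by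
  rcases o.total 1 g with h | rfl | h
  · exact .inl h
  · exact absurd rfl hg
  · exact .inr (by simpa using o.lt_iff_inv_mul_mem_positiveCone.1 h)

theorem mul_mem_positiveCone (o : LeftOrdering G) {g h : G} (hg : g ∈ o.positiveCone)
    (hh : h ∈ o.positiveCone) : g * h ∈ o.positiveCone :=
  o.trans 1 g (g * h) hg (o.lt_iff_inv_mul_mem_positiveCone.2 (by simpa using hh))

theorem eq_of_positiveCone_subset {o o' : LeftOrdering G}
    (h : o.positiveCone ⊆ o'.positiveCone) : o = o' := by
  have hlt : ∀ {g k}, o.lt g k → o'.lt g k := fun hgk =>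
    o'.lt_iff_inv_mul_mem_positiveCone.2 (h (o.lt_iff_inv_mul_mem_positiveCone.1 hgk))
  ext g k
  refine ⟨hlt, fun hgk => ?_⟩
  rcases o.total g k with hgk' | rfl | hkg
  · exact hgk'
  · exact (o'.irrefl g hgk).elim
  · exact (o'.irrefl g (o'.trans g k g hgk (hlt hkg))).elim

theorem eq_top_of_positiveCone_subset (o : LeftOrdering G) {H : Subgroup G}
    (h : o.positiveCone ⊆ H) : H = ⊤ := by
  refine (Subgroup.eq_top_iff' H).2 fun g => ?_
  rcases eq_or_ne g 1 with rfl | hg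
  · exact one_mem H
  · exact (o.mem_or_inv_mem_positiveCone hg).elim (fun hg => h hg)
      fun hg => inv_mem_iff.1 (h hg)

theorem isOpen_setOf_mem_positiveCone (g : G) :
    IsOpen {o : LeftOrdering G | g ∈ o.positiveCone} := by
  rcases eq_or_ne g 1 with rfl | hg
  · simp [one_notMem_positiveCone]
  · have hsign : Continuous fun o : LeftOrdering G => o.sign ⟨g, hg⟩ :=
      (continuous_apply (⟨g, hg⟩ : {g : G // g ≠ 1})).comp (continuous_induced_dom (f := sign))
    simpa [sign, Set.preimage] using (isOpen_discrete {true}).preimage hsign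

theorem isIsolated_of_positiveCone_eq_closure (o : LeftOrdering G) {s : Set G} (hs : s.Finite)
    (h : o.positiveCone = Subsemigroup.closure s) : o.IsIsolated := by
  have hsingleton : {o} = ⋂ g ∈ s, {o' : LeftOrdering G | g ∈ o'.positiveCone} := by
    ext o'
    simp only [Set.mem_singleton_iff, Set.mem_iInter, Set.mem_ofPred_eq]
    refine ⟨?_, fun hs' => (eq_of_positiveCone_subset ?_).symm⟩
    · rintro rfl g hg
      exact h ▸ Subsemigroup.subset_closure hg
    · let P : Subsemigroup G := ⟨o'.positiveCone, o'.mul_mem_positiveCone⟩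
      exact h ▸ (Subsemigroup.closure_le (S := P)).2 hs'
  rw [IsIsolated, hsingleton]
  exact hs.isOpen_biInter fun g _ => isOpen_setOf_mem_positiveCone g

end LeftOrdering

section Words

variable {G : Type*} [Group G] {k : ℕ}

theorem wordEval_append (S : Fin k → G) (v w : List (Fin k × Bool)) :
    wordEval S (v ++ w) = wordEval S v * wordEval S w := by
  simp [wordEval]

theorem wordEval_mem_closure (S : Fin k → G) (w : List (Fin k × Bool)) :
    wordEval S w ∈ Subgroup.closure (Set.range S) := by
  refine list_prod_mem fun g hg => ?_
  obtain ⟨⟨i, ε⟩, -, rfl⟩ := List.mem_map.1 hg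
  have hi : S i ∈ Subgroup.closure (Set.range S) := Subgroup.subset_closure ⟨i, rfl⟩
  cases ε
  · exact inv_mem hi
  · exact hi

theorem IsPositiveWord.append {i j : Fin k} {v w : List (Fin k × Bool)}
    (hv : IsPositiveWord i v) (hw : IsPositiveWord j w) :
    IsPositiveWord (min i j) (v ++ w) := by
  obtain ⟨hv_mem, hv_inv, hv_le⟩ := hv
  obtain ⟨hw_mem, hw_inv, hw_le⟩ := hw
  refine ⟨?_, ?_, fun p hp => ?_⟩
  · rcases min_choice i j with h | h <;> simp [h, hv_mem, hw_mem]
  · rw [List.mem_append, not_or]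
    rcases lt_trichotomy i j with hij | rfl | hij
    · rw [min_eq_left hij.le]
      exact ⟨hv_inv, fun h => (hw_le _ h).not_gt hij⟩
    · rw [min_self]
      exact ⟨hv_inv, hw_inv⟩
    · rw [min_eq_right hij.le]
      exact ⟨fun h => (hv_le _ h).not_gt hij, hw_inv⟩
  · rcases List.mem_append.1 hp with hp | hp
    · exact (min_le_left i j).trans (hv_le p hp)
    · exact (min_le_right i j).trans (hw_le p hp)

/-- The `σ(S)`-positive elements, bundled as a subsemigroup. -/
def sigmaPositiveSubsemigroup (S : Fin k → G) : Subsemigroup G where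
  carrier := sigmaPositive S
  mul_mem' := by
    rintro _ _ ⟨i, v, hv, rfl⟩ ⟨j, w, hw, rfl⟩
    exact ⟨_, _, hv.append hw, wordEval_append S v w⟩

theorem wordPositive_subset_sigmaPositive (S : Fin k → G) : wordPositive S ⊆ sigmaPositive S := by
  refine (Subsemigroup.closure_le (S := sigmaPositiveSubsemigroup S)).2 ?_
  rintro _ ⟨i, rfl⟩
  exact ⟨i, [(i, true)], by simp [IsPositiveWord], by simp [wordEval]⟩

theorem definesIsolatedOrdering_of_total (S : Fin k → G) (hone : 1 ∉ wordPositive S)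
    (htotal : ∀ g ≠ 1, g ∈ wordPositive S ∨ g⁻¹ ∈ wordPositive S) : DefinesIsolatedOrdering S := by
  let o := LeftOrdering.ofPositiveCone (Subsemigroup.closure (Set.range S)) hone htotal
  have ho : o.positiveCone = wordPositive S := LeftOrdering.positiveCone_ofPositiveCone ..
  refine ⟨o.eq_top_of_positiveCone_subset (ho ▸ ?_), o, ho,
    o.isIsolated_of_positiveCone_eq_closure (Set.finite_range S) ho⟩
  exact (Subsemigroup.closure_le (S := (Subgroup.closure (Set.range S)).toSubsemigroup)).2
    Subgroup.subset_closure

theorem definesDehornoyLikeOrdering_of_total (S : Fin k → G) (hone : 1 ∉ sigmaPositive S)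
    (htotal : ∀ g ≠ 1, g ∈ sigmaPositive S ∨ g⁻¹ ∈ sigmaPositive S) :
    DefinesDehornoyLikeOrdering S := by
  let o := LeftOrdering.ofPositiveCone (sigmaPositiveSubsemigroup S) hone htotal
  have ho : o.positiveCone = sigmaPositive S := LeftOrdering.positiveCone_ofPositiveCone ..
  refine ⟨o.eq_top_of_positiveCone_subset (ho ▸ ?_), o, ho⟩
  rintro _ ⟨-, w, -, rfl⟩
  exact wordEval_mem_closure S w

end Words

section Pairs

variable {G : Type*} [Group G]

/-- The elements represented by the words on `s^{±1}, t^{±1}` that contain `s` but not `s⁻¹`,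
described without words. -/
def leadingPositive (s t : G) : Subsemigroup G :=
  Subsemigroup.closure (Set.range fun p : ℤ × ℤ => t ^ p.1 * s * t ^ p.2)

theorem zpow_mul_mul_zpow_mem_leadingPositive (s t : G) (j k : ℤ) :
    t ^ j * s * t ^ k ∈ leadingPositive s t :=
  Subsemigroup.subset_closure ⟨(j, k), rfl⟩

theorem zpow_mul_mem_leadingPositive {s t g : G} (hg : g ∈ leadingPositive s t) (j : ℤ) :
    t ^ j * g ∈ leadingPositive s t := by
  induction hg using Subsemigroup.closure_induction with
  | mem g hg =>
    obtain ⟨⟨i, k⟩, rfl⟩ := hg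
    simpa [zpow_add, mul_assoc] using zpow_mul_mul_zpow_mem_leadingPositive s t (j + i) k
  | mul g h _ hh ihg _ => exact mul_assoc (t ^ j) g h ▸ mul_mem ihg hh

theorem leadingPositive_mul_inv (a b : G) :
    leadingPositive (a * b) b⁻¹ = leadingPositive a b := by
  refine le_antisymm (Subsemigroup.closure_le.2 ?_) (Subsemigroup.closure_le.2 ?_)
  · rintro _ ⟨⟨j, k⟩, rfl⟩
    simpa [zpow_add, zpow_sub, mul_assoc] using
      zpow_mul_mul_zpow_mem_leadingPositive a b (-j) (1 - k)
  · rintro _ ⟨⟨j, k⟩, rfl⟩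
    simpa [zpow_add, zpow_sub, mul_assoc] using
      zpow_mul_mul_zpow_mem_leadingPositive (a * b) b⁻¹ (-j) (1 - k)

theorem wordEval_pair_mem (s t : G) (w : List (Fin 2 × Bool)) (hw : (0, false) ∉ w) :
    ((0, true) ∈ w → wordEval ![s, t] w ∈ leadingPositive s t) ∧
      ((0, true) ∉ w → ∃ k : ℤ, t ^ k = wordEval ![s, t] w) := by
  induction w with
  | nil => exact ⟨by simp, fun _ => ⟨0, by simp [wordEval]⟩⟩
  | cons p w ih =>
    obtain ⟨ih_mem, ih_zpow⟩ := ih fun h => hw (List.mem_cons_of_mem p h)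
    have hs : ∀ k : ℤ, s * t ^ k ∈ leadingPositive s t := fun k => by
      simpa using zpow_mul_mul_zpow_mem_leadingPositive s t 0 k
    have ht : ∀ e : ℤ, ((0, true) ∈ w → t ^ e * wordEval ![s, t] w ∈ leadingPositive s t) ∧
        ((0, true) ∉ w → ∃ k : ℤ, t ^ k = t ^ e * wordEval ![s, t] w) := fun e =>
      ⟨fun h => zpow_mul_mem_leadingPositive (ih_mem h) e, fun h =>
        (ih_zpow h).elim fun k hk => ⟨e + k, by rw [zpow_add, hk]⟩⟩
    rw [← List.singleton_append, wordEval_append]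
    match p with
    | (0, false) => simp at hw
    | (0, true) =>
      refine ⟨fun _ => ?_, by simp⟩
      by_cases h : (0, true) ∈ w
      · simpa [wordEval] using mul_mem (hs 0) (ih_mem h)
      · obtain ⟨k, hk⟩ := ih_zpow h
        rw [← hk]
        simpa [wordEval] using hs k
    | (1, true) => simpa [wordEval] using ht 1
    | (1, false) => simpa [wordEval] using ht (-1)

theorem exists_wordEval_pair_eq_zpow (s t : G) (k : ℤ) :
    ∃ w : List (Fin 2 × Bool), (∀ ε, (0, ε) ∉ w) ∧ wordEval ![s, t] w = t ^ k := by
  obtain ⟨e, rfl | rfl⟩ := k.eq_nat_or_neg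
  · exact ⟨.replicate e (1, true), by simp [List.mem_replicate], by simp [wordEval]⟩
  · exact ⟨.replicate e (1, false), by simp [List.mem_replicate], by simp [wordEval]⟩

theorem leadingPositive_subset_sigmaPositive (s t : G) :
    (leadingPositive s t : Set G) ⊆ sigmaPositive ![s, t] := by
  refine (Subsemigroup.closure_le (S := sigmaPositiveSubsemigroup ![s, t])).2 ?_
  rintro _ ⟨⟨j, k⟩, rfl⟩
  obtain ⟨v, hv, hv_eval⟩ := exists_wordEval_pair_eq_zpow s t j
  obtain ⟨w, hw, hw_eval⟩ := exists_wordEval_pair_eq_zpow s t k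
  refine ⟨0, v ++ [(0, true)] ++ w, ⟨by simp, by simp [hv, hw], fun _ _ => Fin.zero_le _⟩, ?_⟩
  rw [wordEval_append, wordEval_append, hv_eval, hw_eval]
  simp [wordEval]

theorem sigmaPositive_pair (s t : G) :
    sigmaPositive ![s, t] =
      (leadingPositive s t : Set G) ∪ Set.range fun e : ℕ => t ^ (e + 1) := by
  refine subset_antisymm ?_ (Set.union_subset (leadingPositive_subset_sigmaPositive s t) ?_)
  · rintro _ ⟨i, w, ⟨hw_mem, hw_inv, hw_le⟩, rfl⟩
    match i with
    | 0 => exact .inl ((wordEval_pair_mem s t w hw_inv).1 hw_mem)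
    | 1 =>
      have hw : w = List.replicate w.length (1, true) := by
        refine List.eq_replicate_of_mem fun p hp => ?_
        match p with
        | (0, _) => exact absurd (hw_le _ hp) (by simp)
        | (1, false) => exact absurd hp hw_inv
        | (1, true) => rfl
      obtain ⟨e, he⟩ := Nat.exists_eq_add_one.2 (List.length_pos_of_mem hw_mem)
      exact .inr ⟨e, by rw [hw, he]; simp [wordEval]⟩
  · rintro _ ⟨e, rfl⟩
    refine ⟨1, List.replicate (e + 1) (1, true), ⟨by simp, by simp [List.mem_replicate], ?_⟩,
      by simp [wordEval]⟩
    intro p hp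
    rw [List.eq_of_mem_replicate hp]

theorem definesDehornoyLikeOrdering_mul_inv {a b : G} (o : LeftOrdering G)
    (ho : o.positiveCone = wordPositive ![a, b])
    (habs : ∀ j k : ℤ, b ^ j * a * b ^ k ∈ o.positiveCone) :
    DefinesDehornoyLikeOrdering ![a * b, b⁻¹] := by
  let P : Subsemigroup G := ⟨o.positiveCone, o.mul_mem_positiveCone⟩
  have hleading : (leadingPositive a b : Set G) ⊆ o.positiveCone := by
    refine (Subsemigroup.closure_le (S := P)).2 ?_
    rintro _ ⟨⟨j, k⟩, rfl⟩
    exact habs j k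
  have hb_pow : ∀ e : ℕ, b ^ (e + 1) ∈ o.positiveCone := by
    have hb : b ∈ o.positiveCone := ho ▸ Subsemigroup.subset_closure ⟨1, rfl⟩
    intro e
    induction e with
    | zero => rwa [zero_add, pow_one]
    | succ e ih => exact pow_succ b (e + 1) ▸ o.mul_mem_positiveCone ih hb
  have hsigma : sigmaPositive ![a * b, b⁻¹] =
      (leadingPositive a b : Set G) ∪ Set.range fun e : ℕ => b⁻¹ ^ (e + 1) := by
    rw [sigmaPositive_pair, leadingPositive_mul_inv]
  have hcone : ∀ g ∈ o.positiveCone,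
      g ∈ sigmaPositive ![a * b, b⁻¹] ∨ g⁻¹ ∈ sigmaPositive ![a * b, b⁻¹] := by
    intro g hg
    rw [ho] at hg
    rw [hsigma]
    rcases sigmaPositive_pair a b ▸ wordPositive_subset_sigmaPositive _ hg with hg | ⟨e, rfl⟩
    · exact .inl (.inl hg)
    · exact .inr (.inr ⟨e, inv_pow b (e + 1)⟩)
  refine definesDehornoyLikeOrdering_of_total _ ?_ fun g hg => ?_
  · rw [hsigma]
    rintro (h | ⟨e, he⟩)
    · exact o.one_notMem_positiveCone (hleading h)
    · simp only [inv_pow, inv_eq_one] at he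
      exact o.one_notMem_positiveCone (he ▸ hb_pow e)
  · rcases o.mem_or_inv_mem_positiveCone hg with hg | hg
    · exact hcone g hg
    · simpa [or_comm] using hcone g⁻¹ hg

theorem mem_subsemigroupClosure_of_ne_one {s : Set G} {g : G} (hg : g ∈ Submonoid.closure s)
    (hne : g ≠ 1) : g ∈ Subsemigroup.closure s := by
  rw [← SetLike.mem_coe, Submonoid.closure_eq_one_union] at hg
  exact hg.resolve_left hne

theorem mul_mem_subsemigroupClosure {s : Set G} {g h : G} (hg : g ∈ Subsemigroup.closure s)
    (hh : h ∈ Submonoid.closure s) : g * h ∈ Subsemigroup.closure s := by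
  rcases eq_or_ne h 1 with rfl | hne
  · rwa [mul_one]
  · exact mul_mem hg (mem_subsemigroupClosure_of_ne_one hh hne)

/-- Conjugating by `a` moves negative powers of `b` across `a`, turning them into elements of
`M`. -/
theorem zpow_mul_mul_zpow_mem {M : Submonoid G} {a b : G} (ha : a ∈ M) (hb : b ∈ M)
    (hright : a * b⁻¹ * a⁻¹ ∈ M) (hleft : a⁻¹ * b⁻¹ * a ∈ M)
    (hboth : a⁻¹ * b⁻¹ * a * b⁻¹ * a⁻¹ ∈ M) (j k : ℤ) : b ^ j * a * b ^ k ∈ M := by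
  have hright_pow (e : ℕ) : a * b⁻¹ ^ e * a⁻¹ ∈ M := conj_pow (a := a) ▸ pow_mem hright e
  have hleft_pow (e : ℕ) : a⁻¹ * b⁻¹ ^ e * a ∈ M := by
    have h := conj_pow (a := a⁻¹) (b := b⁻¹) (i := e)
    rw [inv_inv] at h
    exact h ▸ pow_mem hleft e
  obtain ⟨d, rfl | rfl⟩ := j.eq_nat_or_neg <;> obtain ⟨e, rfl | rfl⟩ := k.eq_nat_or_neg <;>
    simp only [zpow_neg, zpow_natCast]
  · exact mul_mem (mul_mem (pow_mem hb d) ha) (pow_mem hb e)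
  · simpa [mul_assoc] using mul_mem (mul_mem (pow_mem hb d) (hright_pow e)) ha
  · simpa [mul_assoc] using mul_mem (mul_mem ha (hleft_pow d)) (pow_mem hb e)
  · match d, e with
    | 0, e => simpa [mul_assoc] using mul_mem (hright_pow e) ha
    | d, 0 => simpa [mul_assoc] using mul_mem ha (hleft_pow d)
    | d + 1, e + 1 =>
      have hsplit : (b ^ (d + 1))⁻¹ * a * (b ^ (e + 1))⁻¹ =
          a * (a⁻¹ * b⁻¹ ^ d * a) * (a⁻¹ * b⁻¹ * a * b⁻¹ * a⁻¹) * (a * b⁻¹ ^ e * a⁻¹) * a := by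
        rw [← inv_pow, ← inv_pow, pow_succ b⁻¹ d, pow_succ' b⁻¹ e]
        group
      rw [hsplit]
      exact mul_mem (mul_mem (mul_mem (mul_mem ha (hleft_pow d)) hboth) (hright_pow e)) ha

end Pairs

section Blocks

variable {G : Type*} [Group G] {m n : ℕ} {x y : G}

theorem commute_pow_of_pow_eq_pow (hxy : x ^ m = y ^ n)
    (hgen : Subgroup.closure {x, y} = ⊤) (g : G) : Commute (x ^ m) g := by
  have hle : Subgroup.closure {x, y} ≤ Subgroup.centralizer {x ^ m} := by
    rw [Subgroup.closure_le]
    rintro _ (rfl | rfl)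
    · exact Subgroup.mem_centralizer_singleton_iff.2 (Commute.self_pow _ _)
    · exact Subgroup.mem_centralizer_singleton_iff.2 (hxy ▸ Commute.self_pow _ _)
  exact (Subgroup.mem_centralizer_singleton_iff.1 (hle (hgen ▸ Subgroup.mem_top g))).symm

/-- The elements `y ^ j * x ^ (-i)` with `0 < j < n` and `0 < i < m`. Modulo `x ^ m = y ^ n` they
are the syllable pairs of the free product of the cyclic groups of orders `m` and `n`. -/
def blocks (m n : ℕ) (x y : G) : Set G :=
  {g | ∃ j i, 0 < j ∧ j < n ∧ 0 < i ∧ i < m ∧ y ^ j * (x ^ i)⁻¹ = g}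

/-- The products `x ^ k * β * y ^ j` with `k` an integer, `β` a product of blocks, and `j < n`.
They lift the normal forms of the free product of the cyclic groups of orders `m` and `n`. -/
def normalForms (m n : ℕ) (x y : G) : Set G :=
  {g | ∃ k : ℤ, ∃ β ∈ Submonoid.closure (blocks m n x y), ∃ j < n, x ^ k * β * y ^ j = g}

theorem zpow_mul_mem_normalForms {g : G} (hg : g ∈ normalForms m n x y) (k : ℤ) :
    x ^ k * g ∈ normalForms m n x y := by
  obtain ⟨l, β, hβ, j, hj, rfl⟩ := hg
  exact ⟨k + l, β, hβ, j, hj, by simp only [zpow_add, mul_assoc]⟩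

theorem mul_block_mem_normalForms {β : G} (hβ : β ∈ Submonoid.closure (blocks m n x y))
    {i j : ℕ} (hj : 0 < j) (hjn : j < n) (him : i < m) :
    β * (y ^ j * (x ^ i)⁻¹) ∈ normalForms m n x y := by
  rcases i.eq_zero_or_pos with rfl | hi
  · exact ⟨0, β, hβ, j, hjn, by simp⟩
  · exact ⟨0, _, mul_mem hβ (Submonoid.subset_closure ⟨j, i, hj, hjn, hi, him, rfl⟩), 0,
      hj.trans hjn, by simp⟩

theorem mul_y_mem_normalForms (hn : 0 < n) (hxy : x ^ m = y ^ n)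
    (hcomm : ∀ g, Commute (x ^ m) g) {g : G} (hg : g ∈ normalForms m n x y) :
    g * y ∈ normalForms m n x y := by
  obtain ⟨k, β, hβ, j, hj, rfl⟩ := hg
  rcases (Nat.succ_le_of_lt hj).lt_or_eq with hj | rfl
  · exact ⟨k, β, hβ, j + 1, hj, by rw [pow_succ, mul_assoc _ _ y]⟩
  · refine ⟨k + m, β, hβ, 0, hn, ?_⟩
    rw [mul_assoc _ _ y, ← pow_succ, ← hxy, zpow_add, zpow_natCast, mul_assoc _ _ β,
      (hcomm β).eq, pow_zero, mul_one, mul_assoc]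

theorem mul_x_mem_normalForms (hm : 0 < m) (hn : 0 < n)
    (hcomm : ∀ g, Commute (x ^ m) g) {g : G} (hg : g ∈ normalForms m n x y) :
    g * x ∈ normalForms m n x y := by
  obtain ⟨k, β, hβ, j, hj, rfl⟩ := hg
  rw [mul_assoc, mul_assoc]
  apply zpow_mul_mem_normalForms
  rcases j.eq_zero_or_pos with rfl | hj_pos
  · rw [pow_zero, one_mul]
    induction hβ using Submonoid.closure_induction_right with
    | one => exact ⟨1, 1, one_mem _, 0, hn, by simp⟩
    | mul_right β hβ _ hblock _ =>
      obtain ⟨j, i, hj, hjn, hi, him, rfl⟩ := hblock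
      have hpeel : β * (y ^ j * (x ^ i)⁻¹) * x = β * (y ^ j * (x ^ (i - 1))⁻¹) := by
        obtain ⟨i, rfl⟩ := Nat.exists_eq_add_one.2 hi
        rw [Nat.add_sub_cancel, pow_succ']
        group
      rw [hpeel]
      exact mul_block_mem_normalForms hβ hj hjn (by omega)
  · have hcarry : β * (y ^ j * x) = x ^ (m : ℤ) * (β * (y ^ j * (x ^ (m - 1))⁻¹)) := by
      rw [zpow_natCast, (hcomm _).eq, ← mul_pow_sub_one hm.ne' x, (Commute.self_pow x _).eq]
      group
    rw [hcarry]
    exact zpow_mul_mem_normalForms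
      (mul_block_mem_normalForms hβ hj_pos hj (Nat.sub_one_lt hm.ne')) _

theorem mul_inv_mem_normalForms (hcomm : ∀ g, Commute (x ^ m) g) {u : G} {e : ℕ} (he : 0 < e)
    (hu_pow : u ^ e = x ^ m) (hu : ∀ g ∈ normalForms m n x y, g * u ∈ normalForms m n x y)
    {g : G} (hg : g ∈ normalForms m n x y) : g * u⁻¹ ∈ normalForms m n x y := by
  have hpow (d : ℕ) : g * u ^ d ∈ normalForms m n x y := by
    induction d with
    | zero => rwa [pow_zero, mul_one]
    | succ d ih => exact pow_succ u d ▸ mul_assoc g _ u ▸ hu _ ih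
  have hinv : g * u⁻¹ = x ^ (-(m : ℤ)) * (g * u ^ (e - 1)) := by
    rw [zpow_neg, zpow_natCast, eq_inv_mul_iff_mul_eq, (hcomm _).eq, ← hu_pow,
      ← mul_pow_sub_one he.ne', mul_assoc, inv_mul_cancel_left]
  exact hinv ▸ zpow_mul_mem_normalForms (hpow _) _

theorem mem_normalForms (hm : 0 < m) (hn : 0 < n) (hxy : x ^ m = y ^ n)
    (hgen : Subgroup.closure {x, y} = ⊤) (g : G) : g ∈ normalForms m n x y := by
  have hcomm := commute_pow_of_pow_eq_pow hxy hgen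
  have hx : ∀ g ∈ normalForms m n x y, g * x ∈ normalForms m n x y :=
    fun _ => mul_x_mem_normalForms hm hn hcomm
  have hy : ∀ g ∈ normalForms m n x y, g * y ∈ normalForms m n x y :=
    fun _ => mul_y_mem_normalForms hn hxy hcomm
  have hg : g ∈ Subgroup.closure {x, y} := hgen ▸ Subgroup.mem_top g
  induction hg using Subgroup.closure_induction_right with
  | one => exact ⟨0, 1, one_mem _, 0, hn, by simp⟩
  | mul_right g _ u hu hg => rcases hu with rfl | rfl; exacts [hx g hg, hy g hg]
  | mul_inv_cancel g _ u hu hg =>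
    rcases hu with rfl | rfl
    · exact mul_inv_mem_normalForms hcomm hm rfl hx hg
    · exact mul_inv_mem_normalForms hcomm hn hxy.symm hy hg

theorem pow_mul_inv_pow_mem {M : Submonoid G} (hx : x ∈ M) (hb : y * (x ^ (m - 1))⁻¹ ∈ M)
    {i j : ℕ} (hj : 0 < j) (hi : i < m) : y ^ j * (x ^ i)⁻¹ ∈ M := by
  have hy : y ∈ M := by simpa using mul_mem hb (pow_mem hx (m - 1))
  have hsplit : y ^ j * (x ^ i)⁻¹ =
      y ^ (j - 1) * (y * (x ^ (m - 1))⁻¹) * x ^ (m - 1 - i) := by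
    rw [pow_sub x (Nat.le_sub_one_of_lt hi), ← pow_sub_one_mul hj.ne' y]
    group
  rw [hsplit]
  exact mul_mem (mul_mem (pow_mem hy _) hb) (pow_mem hx _)

theorem inv_pow_mul_mem {M : Submonoid G} (hm : 0 < m) (hxy : x ^ m = y ^ n) (hx : x ∈ M)
    (hb : y * (x ^ (m - 1))⁻¹ ∈ M) {j : ℕ} (hj : j < n) : (y ^ j)⁻¹ * x ∈ M := by
  have hcarry : (y ^ j)⁻¹ * x = y ^ (n - j) * (x ^ (m - 1))⁻¹ := by
    rw [eq_mul_inv_iff_mul_eq, mul_assoc, mul_pow_sub_one hm.ne', hxy, inv_mul_eq_iff_eq_mul,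
      ← pow_add, Nat.add_sub_cancel' hj.le]
  rw [hcarry]
  exact pow_mul_inv_pow_mem hx hb (Nat.sub_pos_of_lt hj) (Nat.sub_one_lt hm.ne')

theorem mul_pow_mem_and_inv_mul_mem {M : Submonoid G} (hm : 0 < m) (hxy : x ^ m = y ^ n)
    (hx : x ∈ M) (hb : y * (x ^ (m - 1))⁻¹ ∈ M) {β : G}
    (hβ : β ∈ Submonoid.closure (blocks m n x y)) {j : ℕ} (hj : j < n) :
    β * y ^ j ∈ M ∧ (β * y ^ j)⁻¹ * x ∈ M := by
  induction hβ using Submonoid.closure_induction_left with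
  | one =>
    have hy : y ∈ M := by simpa using mul_mem hb (pow_mem hx (m - 1))
    simpa using ⟨pow_mem hy j, inv_pow_mul_mem hm hxy hx hb hj⟩
  | mul_left β hblock γ _ ih =>
    obtain ⟨l, i, hl, hln, hi, him, rfl⟩ := hblock
    have hsplit : (y ^ l * (x ^ i)⁻¹ * γ * y ^ j)⁻¹ * x =
        (γ * y ^ j)⁻¹ * x * x ^ (i - 1) * ((y ^ l)⁻¹ * x) := by
      rw [mul_assoc _ x, mul_pow_sub_one hi.ne']
      group
    rw [hsplit, mul_assoc]
    exact ⟨mul_mem (pow_mul_inv_pow_mem hx hb hl him) ih.1,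
      mul_mem (mul_mem ih.2 (pow_mem hx _)) (inv_pow_mul_mem hm hxy hx hb hln)⟩

theorem mem_or_inv_mem_of_pow_eq_pow {M : Submonoid G} (hm : 0 < m) (hn : 0 < n)
    (hxy : x ^ m = y ^ n) (hgen : Subgroup.closure {x, y} = ⊤) (hx : x ∈ M)
    (hb : y * (x ^ (m - 1))⁻¹ ∈ M) (g : G) : g ∈ M ∨ g⁻¹ ∈ M := by
  obtain ⟨k, β, hβ, j, hj, rfl⟩ := mem_normalForms hm hn hxy hgen g
  obtain ⟨hmem, hinv⟩ := mul_pow_mem_and_inv_mul_mem hm hxy hx hb hβ hj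
  rw [mul_assoc]
  rcases k with k | k
  · exact .inl (mul_mem (by simpa using pow_mem hx k) hmem)
  · refine .inr ?_
    have hsplit : (x ^ Int.negSucc k * (β * y ^ j))⁻¹ = (β * y ^ j)⁻¹ * x * x ^ k := by
      rw [zpow_negSucc, pow_succ']
      group
    exact hsplit ▸ mul_mem hinv (pow_mem hx k)

theorem zpow_mul_mul_zpow_mem_of_pow_eq_pow {M : Submonoid G} (hm : 2 ≤ m) (hn : 2 ≤ n)
    (hmn : (m, n) ≠ (2, 2)) (hxy : x ^ m = y ^ n) (hx : x ∈ M) (hb : y * (x ^ (m - 1))⁻¹ ∈ M)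
    (j k : ℤ) : (y * (x ^ (m - 1))⁻¹) ^ j * x * (y * (x ^ (m - 1))⁻¹) ^ k ∈ M := by
  obtain ⟨m, rfl⟩ := Nat.exists_eq_add_of_le' hm
  obtain ⟨n, rfl⟩ := Nat.exists_eq_add_of_le' hn
  have hy_inv : x ^ (m + 2) * y⁻¹ = y ^ (n + 1) := by rw [hxy, pow_succ, mul_inv_cancel_right]
  have hright : x * (y * (x ^ (m + 1))⁻¹)⁻¹ * x⁻¹ = y ^ (n + 1) * (x ^ 1)⁻¹ := by
    rw [← hy_inv, pow_succ' x (m + 1)]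
    group
  have hleft : x⁻¹ * (y * (x ^ (m + 1))⁻¹)⁻¹ * x = x ^ m * y⁻¹ * x := by
    rw [pow_succ' x m]
    group
  have hboth : x⁻¹ * (y * (x ^ (m + 1))⁻¹)⁻¹ * x * (y * (x ^ (m + 1))⁻¹)⁻¹ * x⁻¹ =
      x ^ m * (y ^ n * (x ^ 1)⁻¹) := by
    rw [hleft, mul_assoc, mul_assoc, ← mul_assoc x, hright, pow_succ' y n]
    group
  refine zpow_mul_mul_zpow_mem (b := y * (x ^ (m + 1))⁻¹) hx hb (hright ▸ ?_) (hleft ▸ ?_)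
    (hboth ▸ ?_) j k
  · exact pow_mul_inv_pow_mem hx hb n.succ_pos (by omega)
  · have hy_inv_mul : y⁻¹ * x ∈ M := by
      simpa using inv_pow_mul_mem (j := 1) (by omega) hxy hx hb (by omega)
    exact mul_assoc _ y⁻¹ x ▸ mul_mem (pow_mem hx m) hy_inv_mul
  · rcases n.eq_zero_or_pos with rfl | hn_pos
    · have hm_pos : m ≠ 0 := by rintro rfl; exact hmn rfl
      have hcancel : x ^ m * (y ^ 0 * (x ^ 1)⁻¹) = x ^ (m - 1) := by
        rw [pow_zero, one_mul, pow_one, ← pow_sub_one_mul hm_pos, mul_inv_cancel_right]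
      exact hcancel ▸ pow_mem hx _
    · exact mul_mem (pow_mem hx m) (pow_mul_inv_pow_mem hx hb hn_pos (by omega))

end Blocks

section Action

theorem one_notMem_closure_of_lt {G α : Type*} [Group G] [Preorder α] (φ : G →* (α ≃o α))
    (p : α) {s : Set G} (hs : ∀ g ∈ s, p < φ g p) : 1 ∉ Subsemigroup.closure s := by
  have hlt : ∀ g ∈ Subsemigroup.closure s, p < φ g p := by
    intro g hg
    induction hg using Subsemigroup.closure_induction with
    | mem g hg => exact hs g hg
    | mul g h _ _ ihg ihh =>
      rw [map_mul]
      exact ihg.trans ((φ g).strictMono ihh)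
  exact fun h => (hlt 1 h).ne (by simp)

/-- The lift of a circle map that fixes the integers and is `t ↦ t ^ α` on `(0, 1)`. For `α ≠ 0` it
is a unit of `CircleDeg1Lift`, which serves to deform the action of a rotation. -/
noncomputable def rpowLift (α : NNReal) : CircleDeg1Lift where
  toFun t := ⌊t⌋ + Int.fract t ^ (α : ℝ)
  monotone' := by
    intro s t hst
    rcases (Int.floor_mono hst).eq_or_lt with hfloor | hfloor
    · have hfract : Int.fract s ≤ Int.fract t := by
        rw [Int.fract, Int.fract, hfloor]
        exact sub_le_sub_right hst _
      simp only [hfloor]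
      gcongr
    · calc (⌊s⌋ : ℝ) + Int.fract s ^ (α : ℝ)
        _ ≤ ⌊s⌋ + 1 := by
          gcongr
          exact Real.rpow_le_one (Int.fract_nonneg s) (Int.fract_lt_one s).le α.2
        _ ≤ ⌊t⌋ := by exact_mod_cast hfloor
        _ ≤ ⌊t⌋ + Int.fract t ^ (α : ℝ) :=
          le_add_of_nonneg_right (Real.rpow_nonneg (Int.fract_nonneg t) _)
  map_add_one' t := by
    rw [Int.floor_add_one, Int.fract_add_one, Int.cast_add, Int.cast_one, add_right_comm]

theorem rpowLift_apply_of_mem_Ico {α : NNReal} {t : ℝ} (ht : t ∈ Set.Ico (0 : ℝ) 1) :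
    rpowLift α t = t ^ (α : ℝ) := by
  change (⌊t⌋ : ℝ) + Int.fract t ^ (α : ℝ) = _
  rw [Int.floor_eq_zero_iff.2 ht, Int.fract_eq_self.2 ht, Int.cast_zero, zero_add]

theorem rpowLift_mul_of_mul_eq_one {α β : NNReal} (h : β * α = 1) :
    rpowLift α * rpowLift β = 1 := by
  have hβ : 0 < (β : ℝ) := NNReal.coe_pos.2 (pos_of_mul_pos_left (h ▸ one_pos) zero_le)
  ext t
  change rpowLift α (⌊t⌋ + Int.fract t ^ (β : ℝ)) = t
  rw [CircleDeg1Lift.map_int_add, rpowLift_apply_of_mem_Ico, ← Real.rpow_mul (Int.fract_nonneg t),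
    ← NNReal.coe_mul, h, NNReal.coe_one, Real.rpow_one, Int.floor_add_fract]
  exact ⟨Real.rpow_nonneg (Int.fract_nonneg t) _,
    Real.rpow_lt_one (Int.fract_nonneg t) (Int.fract_lt_one t) hβ⟩

theorem exists_circleDeg1Lift_units_lt_apply {s c : ℝ} (hs : s ∈ Set.Ioo (0 : ℝ) 1) (hc : 0 ≤ c)
    (hc_lt : c < 1) : ∃ f : CircleDeg1Liftˣ, f 0 = 0 ∧ c < f s := by
  obtain ⟨N, hN⟩ := exists_pow_lt_of_lt_one hs.1 hc_lt
  have hN_ne : N ≠ 0 := by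
    rintro rfl
    exact (pow_zero c ▸ hN).not_gt hs.2
  have hα : (N : NNReal) ≠ 0 := Nat.cast_ne_zero.2 hN_ne
  refine ⟨⟨rpowLift (N : NNReal)⁻¹, rpowLift N, rpowLift_mul_of_mul_eq_one (mul_inv_cancel₀ hα),
    rpowLift_mul_of_mul_eq_one (inv_mul_cancel₀ hα)⟩, ?_, ?_⟩
  · change rpowLift _ 0 = 0
    rw [rpowLift_apply_of_mem_Ico (by simp)]
    exact Real.zero_rpow (by simpa using hN_ne)
  · change c < rpowLift _ s
    rw [rpowLift_apply_of_mem_Ico (Set.Ioo_subset_Ico_self hs), NNReal.coe_inv,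
      NNReal.coe_natCast, Real.lt_rpow_inv_iff_of_pos hc hs.1.le (by positivity),
      Real.rpow_natCast]
    exact hN

/-- Here `X` is the translation by `1 / m`, `Y` is the translation by `1 / n` conjugated by an `f`
with `f 0 = 0` and `f (1 / n)` close to `1`, and `p = (m - 1) / m`. -/
theorem exists_units_circleDeg1Lift {m n : ℕ} (hm : 0 < m) (hn : 2 ≤ n) :
    ∃ X Y : CircleDeg1Liftˣ, X ^ m = Y ^ n ∧
      ∃ p : ℝ, p < X p ∧ p < (Y * (X ^ (m - 1))⁻¹ : CircleDeg1Liftˣ) p := by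
  have hm' : (0 : ℝ) < m := by exact_mod_cast hm
  have hn' : (1 : ℝ) < n := by exact_mod_cast hn
  have hm_cast : ((m - 1 : ℕ) : ℝ) = m - 1 := Nat.cast_pred hm
  obtain ⟨F, hF_zero, hF⟩ := exists_circleDeg1Lift_units_lt_apply (s := 1 / n)
    (c := (m - 1 : ℕ) / m) ⟨by positivity, (div_lt_one (by positivity)).2 hn'⟩ (by positivity)
    ((div_lt_one hm').2 (by rw [hm_cast]; linarith))
  let T (t : ℝ) : CircleDeg1Liftˣ := CircleDeg1Lift.translate (Multiplicative.ofAdd t)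
  have hT_pow {k : ℕ} (hk : 0 < k) : T (1 / k) ^ k = T 1 := by
    rw [CircleDeg1Lift.translate_pow, mul_one_div_cancel (by positivity)]
  have hF_comm : F * T 1 * F⁻¹ = T 1 := by
    rw [mul_inv_eq_iff_eq_mul]
    ext t
    exact CircleDeg1Lift.map_one_add F t
  refine ⟨T (1 / m), F * T (1 / n) * F⁻¹, ?_, (m - 1 : ℕ) / m, ?_, ?_⟩
  · rw [conj_pow, hT_pow hm, hT_pow (by omega), hF_comm]
  · change _ < 1 / (m : ℝ) + _
    simpa using hm'
  · have hX : (T (1 / m) ^ (m - 1))⁻¹ ((m - 1 : ℕ) / m : ℝ) = 0 := by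
      rw [CircleDeg1Lift.translate_pow, CircleDeg1Lift.translate_inv_apply, mul_one_div,
        neg_add_cancel]
    have hF_inv : F⁻¹ 0 = 0 := by
      simpa only [hF_zero] using CircleDeg1Lift.units_inv_apply_apply F 0
    have hY : (F * T (1 / n) * F⁻¹ : CircleDeg1Liftˣ) 0 = F (1 / n) := by
      change F (T (1 / n) (F⁻¹ 0)) = _
      rw [hF_inv, CircleDeg1Lift.translate_apply, add_zero]
    rwa [Units.val_mul, CircleDeg1Lift.mul_apply, hX, hY]

end Action

namespace TorusGroup

variable {m n : ℕ}

theorem x_pow_eq_y_pow (m n : ℕ) : x m n ^ m = y m n ^ n := by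
  have h : PresentedGroup.mk
      ({FreeGroup.of 0 ^ m * (FreeGroup.of 1 ^ n)⁻¹} : Set (FreeGroup (Fin 2)))
      (FreeGroup.of 0 ^ m * (FreeGroup.of 1 ^ n)⁻¹) = 1 :=
    PresentedGroup.one_of_mem (Set.mem_singleton _)
  rwa [map_mul, map_inv, map_pow, map_pow, mul_inv_eq_one] at h

theorem closure_x_y (m n : ℕ) : Subgroup.closure {x m n, y m n} = ⊤ := by
  rw [← PresentedGroup.closure_range_of]
  congr 1
  ext g
  simp [x, y, Fin.exists_fin_two, eq_comm]

theorem exists_hom {H : Type*} [Group H] (u v : H) (h : u ^ m = v ^ n) :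
    ∃ φ : TorusGroup m n →* H, φ (x m n) = u ∧ φ (y m n) = v :=
  ⟨PresentedGroup.toGroup (f := ![u, v]) (by simp [h]), PresentedGroup.toGroup.of _,
    PresentedGroup.toGroup.of _⟩

theorem genA_eq (hm : 0 < m) : genA m n = ![x m n, y m n * (x m n ^ (m - 1))⁻¹] := by
  rw [genA, neg_add_eq_sub, ← neg_sub, zpow_neg, ← Nat.cast_pred hm, zpow_natCast]

theorem genS_eq (hm : 0 < m) :
    genS m n = ![x m n * (y m n * (x m n ^ (m - 1))⁻¹), (y m n * (x m n ^ (m - 1))⁻¹)⁻¹] := by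
  rw [genS, neg_add_eq_sub, ← neg_sub, zpow_neg, ← Nat.cast_pred hm, zpow_natCast, mul_inv_rev,
    inv_inv, mul_assoc]

theorem one_notMem_wordPositive_genA (hm : 0 < m) (hn : 2 ≤ n) : 1 ∉ wordPositive (genA m n) := by
  obtain ⟨X, Y, hXY, p, hX, hb⟩ := exists_units_circleDeg1Lift hm hn
  obtain ⟨φ, rfl, rfl⟩ := exists_hom X Y hXY
  refine one_notMem_closure_of_lt (CircleDeg1Lift.toOrderIso.comp φ) p ?_
  rintro _ ⟨i, rfl⟩
  rw [genA_eq hm]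
  match i with
  | 0 => exact hX
  | 1 =>
    rw [← map_pow, ← map_inv, ← map_mul] at hb
    exact hb

theorem mem_wordPositive_genA_or_inv_mem (hm : 0 < m) (hn : 0 < n) {g : TorusGroup m n}
    (hg : g ≠ 1) : g ∈ wordPositive (genA m n) ∨ g⁻¹ ∈ wordPositive (genA m n) := by
  rw [genA_eq hm]
  have hx : x m n ∈ Submonoid.closure (Set.range ![x m n, y m n * (x m n ^ (m - 1))⁻¹]) :=
    Submonoid.subset_closure ⟨0, rfl⟩
  refine (mem_or_inv_mem_of_pow_eq_pow hm hn (x_pow_eq_y_pow m n) (closure_x_y m n) hx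
    (Submonoid.subset_closure ⟨1, rfl⟩) g).imp ?_ ?_ <;> intro h
  · exact mem_subsemigroupClosure_of_ne_one h hg
  · exact mem_subsemigroupClosure_of_ne_one h (inv_ne_one.2 hg)

theorem definesIsolatedOrdering_genA (hm : 0 < m) (hn : 2 ≤ n) :
    DefinesIsolatedOrdering (genA m n) :=
  definesIsolatedOrdering_of_total _ (one_notMem_wordPositive_genA hm hn) fun _ =>
    mem_wordPositive_genA_or_inv_mem hm (by omega)

theorem definesDehornoyLikeOrdering_genS (hm : 2 ≤ m) (hn : 2 ≤ n) (hmn : (m, n) ≠ (2, 2)) :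
    DefinesDehornoyLikeOrdering (genS m n) := by
  have hm_pos : 0 < m := by omega
  obtain ⟨-, o, ho, -⟩ := definesIsolatedOrdering_genA hm_pos hn
  rw [genA_eq hm_pos] at ho
  rw [genS_eq hm_pos]
  refine definesDehornoyLikeOrdering_mul_inv o ho fun j k => ?_
  let M := Submonoid.closure (Set.range ![x m n, y m n * (x m n ^ (m - 1))⁻¹])
  have hx : x m n ∈ M := Submonoid.subset_closure ⟨0, rfl⟩
  have hb : y m n * (x m n ^ (m - 1))⁻¹ ∈ M := Submonoid.subset_closure ⟨1, rfl⟩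
  -- One factor `b` is split off to land in the subsemigroup and not only in the submonoid `M`.
  rw [ho, ← add_sub_cancel 1 j, zpow_add, zpow_one, mul_assoc, mul_assoc, ← mul_assoc (_ ^ (j - 1))]
  exact mul_mem_subsemigroupClosure (Subsemigroup.subset_closure ⟨1, rfl⟩)
    (zpow_mul_mul_zpow_mem_of_pow_eq_pow hm hn hmn (x_pow_eq_y_pow m n) hx hb (j - 1) k)

end TorusGroup

theorem theorem3p1 (m n : ℕ) (hm : 2 ≤ m) (hn : 2 ≤ n) (hmn : (m, n) ≠ (2, 2)) :
    DefinesDehornoyLikeOrdering (TorusGroup.genS m n) ∧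
      DefinesIsolatedOrdering (TorusGroup.genA m n) :=
  ⟨TorusGroup.definesDehornoyLikeOrdering_genS hm hn hmn,
    TorusGroup.definesIsolatedOrdering_genA (by omega) hn⟩
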